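/- Graphs are finite and simple. For an integer $t \ge 0$, a $t$-tree is a graph obtained by starting with a clique on $t$ vertices and then iteratively adding vertices $v$ such that the neighborhood of $v$ among the previously added vertices is a clique on exactly $t$ vertices. A partial $t$-tree is a subgraph of a $t$-tree, and the treewidth of a graph $G$ is the minimum $t$ for which $G$ is a partial $t$-tree. A fractional coloring of $G$ is an assignment of a Lebesgue measurable set $\phi(v) \subseteq \mathbb R$ of Lebesgue measure $\mu(\phi(v)) = 1$ to each vertex $v$ so that $\phi(u) \cap \phi(v) = \emptyset$ for each edge $uv$, and the fractional chromatic number $\chi_f(G)$ is the infimum of $\mu\bigl(\bigcup_{v \in V(G)} \phi(v)\bigr)$ over all fractional colorings $\phi$ of $G$. Theorem. Let $0 < c < \frac{1}{2}$ be fixed. There are a function $\varepsilon \colon \mathbb N \to \mathbb R$ with $\varepsilon(t) \to 0$ as $t \to \infty$ and an integer $t_0$ (both depending only on $c$) such that for every integer $t \ge t_0$ there exists a graph $G$ of treewidth $t$ and clique number $\lfloor (1-c)t \rfloor$ satisfying \[ \chi_f(G) \ge t + 1 + \tfrac{1}{2} \log(1-2c) - \varepsilon(t), \] where $\log$ is the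 natural logarithm. -/

import Mathlib

open Filter Topology MeasureTheory

namespace FracTreewidth

/-- `BuildsTree H t S` says that the subgraph of `H` induced by the vertex set `S` can be built
by starting with a clique on `t` vertices and then iteratively adding vertices `v` whose set of
neighbors among the vertices added before `v` is a clique `K` on exactly `t` vertices. -/
inductive BuildsTree {W : Type*} (H : SimpleGraph W) (t : ℕ) : Finset W → Prop
  | base (K : Finset W) (hK : H.IsNClique t K) : BuildsTree H t K
  | step (S K : Finset W) (v : W) (hv : v ∉ S) (hS : BuildsTree H t S) (hKS : K ⊆ S)
      (hK : H.IsNClique t K) (hadj : ∀ u ∈ S, H.Adj v u ↔ u ∈ K) :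
      BuildsTree H t (S.cons v hv)

/-- A finite graph `H` is a `t`-tree if its whole vertex set can be built in this way. -/
def IsTree {W : Type*} [Fintype W] (t : ℕ) (H : SimpleGraph W) : Prop :=
  BuildsTree H t Finset.univ

/-- A partial `t`-tree is a graph isomorphic to a (not necessarily induced or spanning) subgraph
of a (finite) `t`-tree. -/
def IsPartialTree {V : Type*} (t : ℕ) (G : SimpleGraph V) : Prop :=
  ∃ (n : ℕ) (H : SimpleGraph (Fin n)), IsTree t H ∧ G.IsContained H

/-- The treewidth of a finite graph `G`: the least `t` for which `G` is a partial `t`-tree. -/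
noncomputable def treewidth {V : Type*} [Finite V] (G : SimpleGraph V) : ℕ :=
  sInf {t : ℕ | IsPartialTree t G}

/-- A fractional coloring assigns to each vertex a Lebesgue measurable set of reals of Lebesgue
measure `1`, so that adjacent vertices receive disjoint sets. (For `volume` on `ℝ`,
`NullMeasurableSet` is Lebesgue measurability.) -/
structure IsFractionalColoring {V : Type*} (G : SimpleGraph V) (φ : V → Set ℝ) : Prop where
  measurable : ∀ v, NullMeasurableSet (φ v) volume
  volume_eq_one : ∀ v, volume (φ v) = 1
  disjoint : ∀ u v, G.Adj u v → Disjoint (φ u) (φ v)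

/-- The fractional chromatic number of a finite graph: the infimum, over all fractional colorings
`φ`, of the Lebesgue measure of the union of all the sets `φ v`. (The infimum is taken in
`[0, ∞]`; it is finite for a finite graph.) -/
noncomputable def fractionalChromaticNumber {V : Type*} [Finite V] (G : SimpleGraph V) : ℝ :=
  (⨅ (φ : V → Set ℝ) (_ : IsFractionalColoring G φ), volume (⋃ v, φ v)).toReal

end FracTreewidth

/-! Put `a = t - k` with `k` about `c * t`. A universal infinite `t`-tree `H` with a subgraph `G` of
clique number at most `a + 1` realizes every admissible back-neighborhood, so bags can be built
adaptively against any coloring. The goal is a bag of `t + 1` vertices made of `k` non-adjacent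
pairs and `t + 1 - 2 * k` further vertices, with all other edges present. Its measure is `t + 1`
minus the overlaps within the pairs.

A pair with small overlap comes from averaging (`exists_pair_inter_le`). Let `Q` be the current
pairs, `U` a set and `V` a clique of `m` vertices, both fully adjacent to `Q`, with no edges between
`U` and `V`. The total overlap over `U ×ˢ V` is at most `m + overlap U`, so some pair overlaps by at
most `(1 + overlap U / m) / U.card`. A clique `U` would be kept small by the clique bound. Instead
`U` also contains cheaply chosen pairs (`exists_pairs_of_clique`), whose overlap stays bounded and
is divided by `m`. With `j` pairs chosen, `U` then has `t - m - 2 * j` vertices. For `m = Nat.sqrt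
t` the costs sum to `-(1/2) * log (1 - 2 * c) + o(1)`.

If all late finite initial segments had cheaper colorings, an ultrafilter would make these finite
choices consistently for almost all of the colorings, and the resulting bag gives a contradiction.
-/

namespace FracTreewidth

/-! ### Clique bounds and graphs given by back-neighborhoods. -/

/-- Every clique of `G` contained in `S` has at most `b` vertices. -/
def CliqueLE (G : SimpleGraph ℕ) (S : Finset ℕ) (b : ℕ) : Prop :=
  ∀ s ⊆ S, G.IsClique (s : Set ℕ) → s.card ≤ b

lemma CliqueLE.mono {G : SimpleGraph ℕ} {S T : Finset ℕ} {b d : ℕ} (h : CliqueLE G S b)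
    (hTS : T ⊆ S) (hbd : b ≤ d) : CliqueLE G T d :=
  fun s hs hc => (h s (hs.trans hTS) hc).trans hbd

lemma cliqueLE_card (G : SimpleGraph ℕ) (S : Finset ℕ) : CliqueLE G S S.card :=
  fun _ hs _ => Finset.card_le_card hs

lemma CliqueLE.union {G : SimpleGraph ℕ} {S T : Finset ℕ} {b d : ℕ} (hS : CliqueLE G S b)
    (hT : CliqueLE G T d) : CliqueLE G (S ∪ T) (b + d) := by
  intro s hs hc
  have h1 := hS (s ∩ S) Finset.inter_subset_right
    (hc.subset (by exact_mod_cast Finset.inter_subset_left))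
  have h2 := hT (s ∩ T) Finset.inter_subset_right
    (hc.subset (by exact_mod_cast Finset.inter_subset_left))
  have h3 : s = (s ∩ S) ∪ (s ∩ T) := by
    rw [← Finset.inter_union_distrib_left, Finset.inter_eq_left.mpr hs]
  calc s.card = ((s ∩ S) ∪ (s ∩ T)).card := by rw [← h3]
    _ ≤ _ := (Finset.card_union_le _ _).trans (add_le_add h1 h2)

lemma cliqueLE_pair {G : SimpleGraph ℕ} {u v : ℕ} (h : ¬ G.Adj u v) : CliqueLE G {u, v} 1 := by
  intro s hs hc
  rw [Finset.card_le_one]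
  intro x hx y hy
  by_contra hxy
  have := hc hx hy hxy
  have hx' := hs hx
  have hy' := hs hy
  simp only [Finset.mem_insert, Finset.mem_singleton] at hx' hy'
  rcases hx' with rfl | rfl <;> rcases hy' with rfl | rfl
  · exact hxy rfl
  · exact h this
  · exact h this.symm
  · exact hxy rfl

lemma cliqueLE_of_indep {G : SimpleGraph ℕ} {S : Finset ℕ}
    (h : ∀ u ∈ S, ∀ v ∈ S, ¬ G.Adj u v) : CliqueLE G S 1 := by
  intro s hs hc
  rw [Finset.card_le_one]
  intro x hx y hy
  by_contra hxy
  exact h x (hs hx) y (hs hy) (hc hx hy hxy)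

/-- The graph on `ℕ` in which the neighbors of `v` below `v` are the elements of `f v`. -/
def backGraph (f : ℕ → Finset ℕ) : SimpleGraph ℕ where
  Adj u v := (u < v ∧ u ∈ f v) ∨ (v < u ∧ v ∈ f u)
  symm := ⟨fun _ _ h => h.symm⟩
  loopless := ⟨fun _ h => by rcases h with h | h <;> exact lt_irrefl _ h.1⟩

lemma backGraph_adj_of_lt {f : ℕ → Finset ℕ} {u v : ℕ} (h : u < v) :
    (backGraph f).Adj v u ↔ u ∈ f v := by
  simp [backGraph, h, h.not_gt]

lemma backGraph_congr {f g : ℕ → Finset ℕ} {n u v : ℕ} (h : ∀ m < n, f m = g m)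
    (hu : u < n) (hv : v < n) : (backGraph f).Adj u v ↔ (backGraph g).Adj u v := by
  simp [backGraph, h u hu, h v hv]

/-! ### The universal `t`-tree and its subgraph. -/

/-- The pair `p = (K, A)` may serve as the sets of neighbors of a vertex `n` in the `t`-tree and in
its subgraph. -/
def ValidRequest (t a : ℕ) (s : ℕ → Finset ℕ × Finset ℕ) (n : ℕ) (p : Finset ℕ × Finset ℕ) :
    Prop :=
  p.1 ⊆ Finset.range n ∧ (backGraph fun m => (s m).1).IsNClique t p.1 ∧ p.2 ⊆ p.1 ∧
    CliqueLE (backGraph fun m => (s m).2) p.2 a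

lemma isClique_congr {G G' : SimpleGraph ℕ} {S : Set ℕ}
    (h : ∀ u ∈ S, ∀ v ∈ S, (G.Adj u v ↔ G'.Adj u v)) : G.IsClique S ↔ G'.IsClique S := by
  constructor <;> intro hc u hu v hv huv
  · exact (h u hu v hv).1 (hc hu hv huv)
  · exact (h u hu v hv).2 (hc hu hv huv)

/-- Validity at `n` involves only edges below `n`; this makes the recursion in `neighbors` well
defined. -/
lemma validRequest_congr {t a n : ℕ} {s s' : ℕ → Finset ℕ × Finset ℕ} (h : ∀ m < n, s m = s' m)
    (p : Finset ℕ × Finset ℕ) : ValidRequest t a s n p ↔ ValidRequest t a s' n p := by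
  unfold ValidRequest
  refine and_congr_right fun h1 => and_congr ?_ (and_congr_right fun h2 => ?_)
  · rw [SimpleGraph.isNClique_iff, SimpleGraph.isNClique_iff]
    refine and_congr_left fun _ => isClique_congr fun u hu v hv => ?_
    exact backGraph_congr (fun m hm => by rw [h m hm]) (Finset.mem_range.1 (h1 hu))
      (Finset.mem_range.1 (h1 hv))
  · refine forall_congr' fun q => forall_congr' fun hq => imp_congr_left ?_
    refine isClique_congr fun u hu v hv => ?_
    exact backGraph_congr (fun m hm => by rw [h m hm])
      (Finset.mem_range.1 (h1 (h2 (hq hu)))) (Finset.mem_range.1 (h1 (h2 (hq hv))))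

/-- An enumeration of all pairs of finite sets, each occurring infinitely often. -/
def request (n : ℕ) : Finset ℕ × Finset ℕ :=
  (Encodable.decode (Nat.unpair n).2).getD (∅, ∅)

lemma exists_request_eq (p : Finset ℕ × Finset ℕ) (N : ℕ) : ∃ n ≥ N, request n = p :=
  ⟨Nat.pair N (Encodable.encode p), Nat.left_le_pair _ _, by simp [request]⟩

open Classical in
/-- The neighborhoods of the vertex `n`, given those of the previous vertices. -/
noncomputable def nextNeighbors (t a : ℕ) (s : ℕ → Finset ℕ × Finset ℕ) (n : ℕ) :
    Finset ℕ × Finset ℕ :=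
  if n < t then (Finset.range n, ∅)
  else if ValidRequest t a s n (request n) then request n else (Finset.range t, ∅)

lemma nextNeighbors_congr {t a n : ℕ} {s s' : ℕ → Finset ℕ × Finset ℕ}
    (h : ∀ m < n, s m = s' m) : nextNeighbors t a s n = nextNeighbors t a s' n := by
  unfold nextNeighbors
  rw [propext (validRequest_congr h (request n))]

/-- The sets of earlier neighbors in the universal `t`-tree and in its universal subgraph. -/
noncomputable def neighbors (t a : ℕ) (n : ℕ) : Finset ℕ × Finset ℕ :=
  nextNeighbors t a (fun m => if _ : m < n then neighbors t a m else (∅, ∅)) n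
termination_by n

lemma neighbors_eq (t a n : ℕ) : neighbors t a n = nextNeighbors t a (neighbors t a) n := by
  rw [neighbors]
  exact nextNeighbors_congr fun m hm => by simp [hm]

/-- The universal `t`-tree `H`, and its universal subgraph `G` of clique number at most `a + 1`. -/
structure IsUniversal (t a : ℕ) (H G : SimpleGraph ℕ) : Prop where
  buildsTree : ∀ n, t ≤ n → BuildsTree H t (Finset.range n)
  le : G ≤ H
  cliqueLE : ∀ S, CliqueLE G S (a + 1)
  base : H.IsNClique t (Finset.range t)
  base_indep : ∀ u ∈ Finset.range t, ∀ v ∈ Finset.range t, ¬ G.Adj u v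
  extend : ∀ K A, H.IsNClique t K → A ⊆ K → CliqueLE G A a → ∀ N, ∃ v ≥ N,
    (∀ u ∈ K, H.Adj v u) ∧ ∀ u ∈ K, G.Adj v u ↔ u ∈ A

/-- Every pair is requested infinitely often and is granted whenever valid. The first `t` vertices
form a clique in `H` but carry no edges of `G`. -/
theorem exists_isUniversal (t a : ℕ) : ∃ H G, IsUniversal t a H G := by
  set s := neighbors t a with hs
  set H := backGraph fun m => (s m).1 with hH
  set G := backGraph fun m => (s m).2 with hG
  have hbase : H.IsNClique t (Finset.range t) := by
    rw [SimpleGraph.isNClique_iff]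
    refine ⟨?_, by simp⟩
    have key : ∀ u v, u < v → v < t → H.Adj v u := by
      intro u v huv hv
      rw [hH, backGraph_adj_of_lt huv, hs, neighbors_eq]
      simp [nextNeighbors, hv, huv]
    intro u hu v hv huv
    simp only [Finset.coe_range, Set.mem_Iio] at hu hv
    rcases lt_or_gt_of_ne huv with h | h
    · exact (key u v h hv).symm
    · exact key v u h hu
  have hvalid : ∀ n, t ≤ n → ValidRequest t a s n (s n) := by
    intro n hn
    rw [show s n = nextNeighbors t a s n from neighbors_eq t a n]
    unfold nextNeighbors
    rw [if_neg hn.not_gt]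
    split_ifs with h
    · exact h
    · refine ⟨by simpa using hn, hbase, by simp, ?_⟩
      intro q hq _
      simp [Finset.subset_empty.1 hq]
  have hsmall : ∀ n, n < t → s n = (Finset.range n, ∅) := by
    intro n hn
    rw [show s n = nextNeighbors t a s n from neighbors_eq t a n]
    simp [nextNeighbors, hn]
  have hA : ∀ n, CliqueLE G (s n).2 a := by
    intro n
    rcases lt_or_ge n t with h | h
    · intro q hq _
      rw [hsmall n h] at hq
      simp [Finset.subset_empty.1 hq]
    · exact (hvalid n h).2.2.2
  refine ⟨H, G, ?_, ?_, ?_, hbase, ?_, ?_⟩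
  · intro n hn
    induction n, hn using Nat.le_induction with
    | base => exact .base _ hbase
    | succ n hn ih =>
      have h := hvalid n hn
      have := BuildsTree.step (Finset.range n) (s n).1 n (by simp) ih h.1 h.2.1
        (fun u hu => backGraph_adj_of_lt (Finset.mem_range.1 hu))
      rwa [Finset.cons_eq_insert, ← Finset.range_add_one] at this
  · have hsub : ∀ n, (s n).2 ⊆ (s n).1 := by
      intro n
      rcases lt_or_ge n t with h | h
      · rw [hsmall n h]; simp
      · exact (hvalid n h).2.2.1
    intro u v h
    rcases h with h | h
    · exact Or.inl ⟨h.1, hsub _ h.2⟩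
    · exact Or.inr ⟨h.1, hsub _ h.2⟩
  · intro S q _ hq
    rcases q.eq_empty_or_nonempty with rfl | hne
    · simp
    · set n := q.max' hne
      have hn : n ∈ q := q.max'_mem hne
      -- Below its largest vertex `n`, a clique lies in the back-neighborhood of `n`, whose cliques
      -- have at most `a` vertices.
      have h1 : q.erase n ⊆ (s n).2 := by
        intro u hu
        have hu' := Finset.mem_erase.1 hu
        have hlt : u < n := lt_of_le_of_ne (q.le_max' u hu'.2) hu'.1
        exact (backGraph_adj_of_lt (f := fun m => (s m).2) hlt).1 (hq hn hu'.2 hu'.1.symm)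
      have h2 := hA n _ h1 (hq.subset (by exact_mod_cast Finset.erase_subset _ _))
      rw [Finset.card_erase_of_mem hn] at h2
      omega
  · intro u hu v hv h
    rw [Finset.mem_range] at hu hv
    rcases h with h | h
    · simp [hsmall v hv] at h
    · simp [hsmall u hu] at h
  · intro K A hK hAK hAc N
    obtain ⟨b, hb⟩ : ∃ b, ∀ u ∈ K, u < b := ⟨K.sup id + 1, fun u hu =>
      Nat.lt_succ_of_le (Finset.le_sup (f := id) hu)⟩
    -- `b` places `n` above all of `K`, and `t` places it past the base clique.
    obtain ⟨n, hn, hr⟩ := exists_request_eq (K, A) (N + b + t)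
    have hv : ValidRequest t a s n (request n) := by
      rw [hr]
      exact ⟨fun u hu => Finset.mem_range.2 (by have := hb u hu; omega), hK, hAK, hAc⟩
    have hsn : s n = (K, A) := by
      rw [show s n = nextNeighbors t a s n from neighbors_eq t a n, ← hr]
      simp [nextNeighbors, hv, show ¬ n < t by omega]
    refine ⟨n, by omega, fun u hu => ?_, fun u hu => ?_⟩
    · rw [hH, backGraph_adj_of_lt (by have := hb u hu; omega), hsn]; exact hu
    · rw [hG, backGraph_adj_of_lt (by have := hb u hu; omega), hsn]

/-! ### Overlaps of sets of measure one. -/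

/-- All the sets `φ v` are Lebesgue measurable of measure one. -/
def IsUnitAssignment (φ : ℕ → Set ℝ) : Prop :=
  ∀ v, NullMeasurableSet (φ v) volume ∧ volume (φ v) = 1

/-- Adjacent vertices of `S` are assigned disjoint sets. -/
def ProperOn (G : SimpleGraph ℕ) (φ : ℕ → Set ℝ) (S : Finset ℕ) : Prop :=
  ∀ u ∈ S, ∀ v ∈ S, G.Adj u v → Disjoint (φ u) (φ v)

/-- The deficiency of the measure of a union of sets of measure one. -/
noncomputable def overlap (φ : ℕ → Set ℝ) (S : Finset ℕ) : ℝ :=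
  S.card - volume.real (⋃ v ∈ S, φ v)

section Overlap

variable {φ : ℕ → Set ℝ}

lemma IsUnitAssignment.ne_top (hφ : IsUnitAssignment φ) (v : ℕ) : volume (φ v) ≠ ⊤ := by
  simp [(hφ v).2]

lemma IsUnitAssignment.real_eq_one (hφ : IsUnitAssignment φ) (v : ℕ) :
    volume.real (φ v) = 1 := by
  simp [Measure.real, (hφ v).2]

lemma IsUnitAssignment.biUnion_ne_top (hφ : IsUnitAssignment φ) (S : Finset ℕ) :
    volume (⋃ v ∈ S, φ v) ≠ ⊤ :=
  ((measure_biUnion_finset_le S φ).trans_lt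
    (ENNReal.sum_lt_top.2 fun v _ => (hφ.ne_top v).lt_top)).ne

lemma IsUnitAssignment.nullMeasurableSet_biUnion (hφ : IsUnitAssignment φ) (S : Finset ℕ) :
    NullMeasurableSet (⋃ v ∈ S, φ v) volume :=
  Finset.nullMeasurableSet_biUnion S fun v _ => (hφ v).1

lemma overlap_empty (φ : ℕ → Set ℝ) : overlap φ ∅ = 0 := by simp [overlap]

lemma overlap_insert (hφ : IsUnitAssignment φ) {S : Finset ℕ} {v : ℕ} (hv : v ∉ S) :
    overlap φ (insert v S) = overlap φ S + volume.real (φ v ∩ ⋃ u ∈ S, φ u) := by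
  have h := measureReal_union_add_inter₀ (s := φ v) (hφ.nullMeasurableSet_biUnion S)
    (hφ.ne_top v) (hφ.biUnion_ne_top S)
  rw [hφ.real_eq_one v] at h
  simp only [overlap, Finset.card_insert_of_notMem hv, Finset.set_biUnion_insert]
  push_cast
  linarith

lemma overlap_insert_of_disjoint (hφ : IsUnitAssignment φ) {S : Finset ℕ} {v : ℕ} (hv : v ∉ S)
    (hd : ∀ u ∈ S, Disjoint (φ v) (φ u)) : overlap φ (insert v S) = overlap φ S := by
  rw [overlap_insert hφ hv, Set.disjoint_iff_inter_eq_empty.1 (Set.disjoint_iUnion₂_right.2 hd)]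
  simp

lemma overlap_insert_pair (hφ : IsUnitAssignment φ) {S : Finset ℕ} {u v : ℕ} (hu : u ∉ S)
    (hv : v ∉ S) (huv : u ≠ v) (hdu : ∀ w ∈ S, Disjoint (φ u) (φ w))
    (hdv : ∀ w ∈ S, Disjoint (φ v) (φ w)) :
    overlap φ (insert u (insert v S)) = overlap φ S + volume.real (φ u ∩ φ v) := by
  rw [overlap_insert hφ (by simp [hu, huv]), overlap_insert_of_disjoint hφ hv hdv,
    Finset.set_biUnion_insert, Set.inter_union_distrib_left,
    Set.disjoint_iff_inter_eq_empty.1 (Set.disjoint_iUnion₂_right.2 hdu), Set.union_empty]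

lemma overlap_union_of_disjoint (hφ : IsUnitAssignment φ) {S F : Finset ℕ} (hSF : Disjoint S F)
    (hd : ∀ u ∈ F, ∀ v ∈ F, u ≠ v → Disjoint (φ u) (φ v))
    (hd' : ∀ u ∈ F, ∀ v ∈ S, Disjoint (φ u) (φ v)) : overlap φ (S ∪ F) = overlap φ S := by
  induction F using Finset.induction_on with
  | empty => simp
  | insert x F hx ih =>
    rw [Finset.disjoint_insert_right] at hSF
    rw [Finset.union_insert, overlap_insert_of_disjoint hφ]
    · exact ih hSF.2
        (fun u hu v hv => hd u (Finset.mem_insert_of_mem hu) v (Finset.mem_insert_of_mem hv))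
        (fun u hu => hd' u (Finset.mem_insert_of_mem hu))
    · simp [hSF.1, hx]
    · intro u hu
      rcases Finset.mem_union.1 hu with h | h
      · exact hd' x (Finset.mem_insert_self _ _) u h
      · exact hd x (Finset.mem_insert_self _ _) u (Finset.mem_insert_of_mem h)
          (fun e => hx (e ▸ h))

/-- The parts outside `X` cover the union minus `X`, so their measures sum to at least the measure
of the union minus that of `X`. -/
lemma sum_measureReal_inter_le (hφ : IsUnitAssignment φ) (U : Finset ℕ) {X : Set ℝ}
    (hX : NullMeasurableSet X volume) (hX' : volume X ≠ ⊤) :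
    ∑ u ∈ U, volume.real (φ u ∩ X) ≤ volume.real X + overlap φ U := by
  have h1 : ∀ u ∈ U, volume.real (φ u ∩ X) = 1 - volume.real (φ u \ X) := by
    intro u _
    have := measureReal_inter_add_sdiff₀ (s := φ u) hX (hφ.ne_top u)
    rw [hφ.real_eq_one u] at this
    linarith
  have h2 : volume.real ((⋃ u ∈ U, φ u) \ X) ≤ ∑ u ∈ U, volume.real (φ u \ X) := by
    simp only [Set.iUnion_sdiff]
    exact measureReal_biUnion_finset_le U fun u => φ u \ X
  have h3 := measureReal_inter_add_sdiff₀ (s := ⋃ u ∈ U, φ u) hX (hφ.biUnion_ne_top U)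
  have h4 : volume.real ((⋃ u ∈ U, φ u) ∩ X) ≤ volume.real X :=
    measureReal_mono Set.inter_subset_right hX'
  rw [Finset.sum_congr rfl h1, Finset.sum_sub_distrib, Finset.sum_const, nsmul_eq_mul, mul_one,
    overlap]
  linarith

/-- Averaging over `U ×ˢ V`: the sets of `V` are disjoint, so summing over `V` gives the
intersection with their union, of measure at most `V.card`. -/
lemma exists_pair_inter_le (hφ : IsUnitAssignment φ) {U V : Finset ℕ} (hU : U.Nonempty)
    (hV : V.Nonempty) (hd : ∀ u ∈ V, ∀ v ∈ V, u ≠ v → Disjoint (φ u) (φ v)) :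
    ∃ p ∈ U ×ˢ V, volume.real (φ p.1 ∩ φ p.2) ≤ (1 + overlap φ U / V.card) / U.card := by
  have hc : (0 : ℝ) < U.card := by exact_mod_cast hU.card_pos
  have hc' : (0 : ℝ) < V.card := by exact_mod_cast hV.card_pos
  have h1 : ∀ u ∈ U, ∑ v ∈ V, volume.real (φ u ∩ φ v) =
      volume.real (φ u ∩ ⋃ v ∈ V, φ v) := by
    intro u _
    rw [Set.inter_iUnion₂, measureReal_biUnion_finset₀ ?_ (fun v _ => (hφ u).1.inter (hφ v).1)
      (fun v _ => measure_ne_top_of_subset Set.inter_subset_left (hφ.ne_top u))]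
    · intro v hv w hw hvw
      exact ((hd v hv w hw hvw).mono Set.inter_subset_right Set.inter_subset_right).aedisjoint
  have h2 : volume.real (⋃ v ∈ V, φ v) ≤ V.card := by
    refine (measureReal_biUnion_finset_le V φ).trans (le_of_eq ?_)
    simp [hφ.real_eq_one]
  have h3 := sum_measureReal_inter_le hφ U (hφ.nullMeasurableSet_biUnion V)
    (hφ.biUnion_ne_top V)
  refine Finset.exists_le_of_sum_le (hU.product hV) ?_
  rw [Finset.sum_product, Finset.sum_congr rfl h1, Finset.sum_const, nsmul_eq_mul,
    Finset.card_product]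
  refine (h3.trans (add_le_add_left h2 _)).trans (le_of_eq ?_)
  push_cast
  field_simp

end Overlap

/-! ### Growing sets inside `t`-cliques of `H`. -/

/-- The set `L` is contained in a clique on `t` vertices of the `t`-tree `H`. -/
def Live (H : SimpleGraph ℕ) (t : ℕ) (L : Finset ℕ) : Prop :=
  ∃ K, H.IsNClique t K ∧ L ⊆ K

lemma Live.mono {H : SimpleGraph ℕ} {t : ℕ} {L L' : Finset ℕ} (h : Live H t L') (hL : L ⊆ L') :
    Live H t L :=
  let ⟨K, hK, hLK⟩ := h
  ⟨K, hK, hL.trans hLK⟩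

variable {H G : SimpleGraph ℕ} {t a : ℕ}

lemma IsUniversal.live_empty (h : IsUniversal t a H G) : Live H t ∅ :=
  ⟨_, h.base, Finset.empty_subset _⟩

lemma IsUniversal.exists_live_insert (h : IsUniversal t a H G) {L A : Finset ℕ}
    (hL : Live H t L) (ht : L.card < t) (hAL : A ⊆ L) (hA : CliqueLE G A a) :
    ∃ v ∉ L, Live H t (insert v L) ∧ ∀ u ∈ L, G.Adj v u ↔ u ∈ A := by
  obtain ⟨K, hK, hLK⟩ := hL
  obtain ⟨v, -, hH, hG⟩ := h.extend K A hK (hAL.trans hLK) hA 0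
  -- Exchanging `d` for the new vertex keeps a `t`-clique of `H` without losing any of `L`.
  obtain ⟨d, hdK, hdL⟩ := Finset.exists_mem_notMem_of_card_lt_card (ht.trans_eq hK.card_eq.symm)
  have hvK : v ∉ K := fun hv => H.irrefl (hH v hv)
  refine ⟨v, fun hv => hvK (hLK hv), ⟨insert v (K.erase d), ?_, ?_⟩, fun u hu => hG u (hLK hu)⟩
  · rw [SimpleGraph.isNClique_iff, Finset.card_insert_of_notMem (by simp [hvK]),
      Finset.card_erase_add_one hdK, hK.card_eq]
    refine ⟨?_, rfl⟩
    rw [Finset.coe_insert, SimpleGraph.isClique_insert]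
    refine ⟨hK.isClique.subset (by exact_mod_cast Finset.erase_subset _ _), fun u hu _ => ?_⟩
    exact hH u (Finset.mem_of_mem_erase (by exact_mod_cast hu))
  · exact Finset.insert_subset_insert v fun u hu =>
      Finset.mem_erase.2 ⟨fun e => hdL (e ▸ hu), hLK hu⟩

/-- The new vertices ignore `L' \ L` in `G`, so only cliques of `L` count against the bound `a + 1`,
while all of `L'` counts against `t`. -/
lemma IsUniversal.exists_clique_extension (h : IsUniversal t a H G) {L L' : Finset ℕ}
    (hLL' : L ⊆ L') (hL' : Live H t L') {b : ℕ} (hb : CliqueLE G L b) (r : ℕ)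
    (hr : L'.card + r ≤ t) (hbr : b + r ≤ a + 1) :
    ∃ U : Finset ℕ, U.card = r ∧ Disjoint L' U ∧ Live H t (L' ∪ U) ∧ G.IsClique (U : Set ℕ) ∧
      ∀ u ∈ U, ∀ w ∈ L', G.Adj u w ↔ w ∈ L := by
  induction r with
  | zero => exact ⟨∅, by simp [hL']⟩
  | succ r ih =>
    obtain ⟨U, hUr, hdisj, hlive, hU, hadj⟩ := ih (by omega) (by omega)
    obtain ⟨v, hv, hvlive, hvadj⟩ := h.exists_live_insert hlive
      (by rw [Finset.card_union_of_disjoint hdisj]; omega)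
      (Finset.union_subset_union_left (t := U) hLL')
      ((hb.union (cliqueLE_card G U)).mono subset_rfl (by omega))
    rw [Finset.mem_union, not_or] at hv
    refine ⟨insert v U, ?_, ?_, ?_, ?_, ?_⟩
    · rw [Finset.card_insert_of_notMem hv.2, hUr]
    · exact Finset.disjoint_insert_right.2 ⟨hv.1, hdisj⟩
    · rwa [Finset.union_insert]
    · rw [Finset.coe_insert, SimpleGraph.isClique_insert]
      exact ⟨hU, fun u hu _ => (hvadj u (Finset.mem_union_right _ hu)).2
        (Finset.mem_union_right _ hu)⟩
    · intro u hu w hw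
      rcases Finset.mem_insert.1 hu with rfl | hu
      · rw [hvadj w (Finset.mem_union_left _ hw), Finset.mem_union]
        exact or_iff_left (Finset.disjoint_left.1 hdisj hw)
      · exact hadj u hu w hw

/-- Every vertex of `S` is adjacent to every vertex of `T`. -/
def FullyAdj (G : SimpleGraph ℕ) (S T : Finset ℕ) : Prop := ∀ u ∈ S, ∀ v ∈ T, G.Adj u v

/-! ### Choosing pairs of small overlap along an ultrafilter. -/

variable {φ : ℕ → ℕ → Set ℝ} {F : Ultrafilter ℕ}

/-- Each finite set of vertices is eventually properly colored by the assignments `φ n`. -/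
def EventuallyProper (G : SimpleGraph ℕ) (φ : ℕ → ℕ → Set ℝ) (F : Ultrafilter ℕ) : Prop :=
  ∀ S : Finset ℕ, ∀ᶠ n in F, ProperOn G (φ n) S

lemma exists_eventually_of_eventually_exists_mem {ι κ : Type*} {F : Ultrafilter ι} {S : Finset κ}
    {p : ι → κ → Prop} (h : ∀ᶠ n in F, ∃ x ∈ S, p n x) : ∃ x ∈ S, ∀ᶠ n in F, p n x := by
  by_contra! hc
  have h2 : ∀ᶠ n in F, ∀ x ∈ S, ¬ p n x :=
    (S.eventually_all).2 fun x hx => hc x hx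
  obtain ⟨n, ⟨x, hx, hp⟩, hn⟩ := (h.and h2).exists
  exact hn x hx hp

/-- `V` is a clique joined to `Q` but not to `U`. The best pair may vary with `n`, but there are
finitely many candidates, so the ultrafilter fixes one. -/
theorem IsUniversal.exists_pair (h : IsUniversal t a H G) (hφ : ∀ n, IsUnitAssignment (φ n))
    (hF : EventuallyProper G φ F) {Q U : Finset ℕ} {b m : ℕ} {s : ℝ} (hQU : Disjoint Q U)
    (hlive : Live H t (Q ∪ U)) (hm : 0 < m) (hU : U.Nonempty) (hcard : Q.card + U.card + m ≤ t)
    (hb : CliqueLE G Q b) (hbm : b + m ≤ a + 1) (hadj : FullyAdj G U Q)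
    (hs : ∀ᶠ n in F, overlap (φ n) U ≤ s) :
    ∃ u v, u ≠ v ∧ ¬ G.Adj u v ∧ u ∉ Q ∧ v ∉ Q ∧ (∀ w ∈ Q, G.Adj u w) ∧ (∀ w ∈ Q, G.Adj v w) ∧
      Live H t (insert u (insert v Q)) ∧
      ∀ᶠ n in F, volume.real (φ n u ∩ φ n v) ≤ (1 + s / m) / U.card := by
  obtain ⟨V, hVm, hVdisj, hVlive, hV, hVadj⟩ := h.exists_clique_extension
    (Finset.subset_union_left (s₁ := Q) (s₂ := U)) hlive hb m
    (by rwa [Finset.card_union_of_disjoint hQU]) hbm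
  have hVne : V.Nonempty := Finset.card_pos.1 (by omega)
  have hev : ∀ᶠ n in F, ∃ p ∈ U ×ˢ V,
      volume.real (φ n p.1 ∩ φ n p.2) ≤ (1 + s / m) / U.card := by
    filter_upwards [hs, hF V] with n hn hn'
    obtain ⟨p, hp, hle⟩ := exists_pair_inter_le (hφ n) hU hVne
      (fun u hu v hv huv => hn' u hu v hv (hV hu hv huv))
    refine ⟨p, hp, hle.trans ?_⟩
    rw [hVm]
    gcongr
  obtain ⟨⟨u, v⟩, hp, huv⟩ := exists_eventually_of_eventually_exists_mem hev
  obtain ⟨hu, hv⟩ := Finset.mem_product.1 hp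
  have huQ : u ∉ Q := Finset.disjoint_right.1 hQU hu
  refine ⟨u, v, ?_, ?_, huQ, ?_, hadj u hu, ?_, hVlive.mono ?_, huv⟩
  · rintro rfl
    exact Finset.disjoint_left.1 hVdisj (Finset.mem_union_right _ hu) hv
  · exact fun e => huQ ((hVadj v hv u (Finset.mem_union_right _ hu)).1 e.symm)
  · exact fun hvQ => Finset.disjoint_left.1 hVdisj (Finset.mem_union_left _ hvQ) hv
  · exact fun w hw => (hVadj v hv w (Finset.mem_union_left _ hw)).2 hw
  · intro x hx
    simp only [Finset.mem_insert] at hx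
    simp only [Finset.mem_union]
    rcases hx with rfl | rfl | hx
    · exact Or.inl (Or.inr hu)
    · exact Or.inr hv
    · exact Or.inl (Or.inl hx)

lemma eventually_overlap_insert_pair_le (hφ : ∀ n, IsUnitAssignment (φ n))
    (hF : EventuallyProper G φ F) {W : Finset ℕ} {u v : ℕ} {s s' : ℝ} (huv : u ≠ v) (hu : u ∉ W)
    (hv : v ∉ W) (hua : ∀ w ∈ W, G.Adj u w) (hva : ∀ w ∈ W, G.Adj v w)
    (hs : ∀ᶠ n in F, overlap (φ n) W ≤ s)
    (hs' : ∀ᶠ n in F, volume.real (φ n u ∩ φ n v) ≤ s') :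
    ∀ᶠ n in F, overlap (φ n) (insert u (insert v W)) ≤ s + s' := by
  filter_upwards [hs, hs', hF (insert u (insert v W))] with n h1 h2 h3
  rw [overlap_insert_pair (hφ n) hu hv huv
    (fun w hw => h3 u (by simp) w (by simp [hw]) (hua w hw))
    (fun w hw => h3 v (by simp) w (by simp [hw]) (hva w hw))]
  exact add_le_add h1 h2

lemma eventually_overlap_union_clique_le (hφ : ∀ n, IsUnitAssignment (φ n))
    (hF : EventuallyProper G φ F) {W U : Finset ℕ} {s : ℝ} (hd : Disjoint W U)
    (hU : G.IsClique (U : Set ℕ)) (hadj : FullyAdj G U W)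
    (hs : ∀ᶠ n in F, overlap (φ n) W ≤ s) : ∀ᶠ n in F, overlap (φ n) (W ∪ U) ≤ s := by
  filter_upwards [hs, hF (W ∪ U)] with n h1 h2
  rw [overlap_union_of_disjoint (hφ n) hd]
  · exact h1
  · exact fun u hu v hv huv => h2 u (by simp [hu]) v (by simp [hv]) (hU hu hv huv)
  · exact fun u hu v hv => h2 u (by simp [hu]) v (by simp [hv]) (hadj u hu v hv)

lemma CliqueLE.insert_pair {W : Finset ℕ} {u v b : ℕ} (hW : CliqueLE G W b)
    (huv : ¬ G.Adj u v) : CliqueLE G (insert u (insert v W)) (b + 1) := by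
  have := hW.union (cliqueLE_pair huv)
  convert this using 1
  ext x
  simp only [Finset.mem_insert, Finset.mem_union, Finset.mem_singleton]
  tauto

/-- The crude construction: each pair consists of one vertex of a `q`-clique and a single new
vertex, at cost `1 / q`. -/
theorem IsUniversal.exists_pairs_of_clique (h : IsUniversal t a H G)
    (hφ : ∀ n, IsUnitAssignment (φ n)) (hF : EventuallyProper G φ F) {Q : Finset ℕ} {b q : ℕ}
    (hQ : Live H t Q) (hb : CliqueLE G Q b) (hq : 0 < q) (i : ℕ)
    (hi : Q.card + 2 * i + q ≤ t + 1) (hi' : b + i + q ≤ a + 2) :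
    ∃ W : Finset ℕ, W.card = 2 * i ∧ Disjoint Q W ∧ Live H t (Q ∪ W) ∧ CliqueLE G W i ∧
      FullyAdj G W Q ∧ ∀ᶠ n in F, overlap (φ n) W ≤ i / q := by
  induction i with
  | zero =>
    refine ⟨∅, by simp, by simp, by simpa using hQ, cliqueLE_card G ∅, by simp [FullyAdj], ?_⟩
    simp [overlap_empty]
  | succ i ih =>
    obtain ⟨W, hWc, hd, hlive, hWb, hadj, hov⟩ := ih (by omega) (by omega)
    have hQWc : (Q ∪ W).card = Q.card + 2 * i := by
      rw [Finset.card_union_of_disjoint hd, hWc]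
    obtain ⟨U, hUc, hUd, hUlive, hU, hUadj⟩ := h.exists_clique_extension subset_rfl hlive
      (hb.union hWb) q (by omega) (by omega)
    have hUne : U.Nonempty := Finset.card_pos.1 (by omega)
    have hUov : ∀ᶠ n in F, overlap (φ n) U ≤ 0 := by
      simpa using eventually_overlap_union_clique_le hφ hF (W := ∅) (s := 0) (by simp) hU
        (by simp [FullyAdj]) (by simp [overlap_empty])
    obtain ⟨u, v, huv, hnadj, hu, hv, hua, hva, hlive', hle⟩ := h.exists_pair hφ hF (m := 1) hUd
      hUlive one_pos hUne (by omega) (hb.union hWb) (by omega)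
      (fun x hx y hy => (hUadj x hx y hy).2 hy) hUov
    rw [Finset.mem_union, not_or] at hu hv
    refine ⟨insert u (insert v W), ?_, ?_, ?_, hWb.insert_pair hnadj, ?_, ?_⟩
    · rw [Finset.card_insert_of_notMem (by simp [huv, hu.2]),
        Finset.card_insert_of_notMem hv.2, hWc]
      ring
    · simp [Finset.disjoint_insert_right, hu.1, hv.1, hd]
    · rwa [Finset.union_insert, Finset.union_insert]
    · intro x hx y hy
      simp only [Finset.mem_insert] at hx
      rcases hx with rfl | rfl | hx
      · exact hua y (Finset.mem_union_left _ hy)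
      · exact hva y (Finset.mem_union_left _ hy)
      · exact hadj x hx y hy
    · have := eventually_overlap_insert_pair_le hφ hF huv hu.2 hv.2
        (fun w hw => hua w (Finset.mem_union_right _ hw))
        (fun w hw => hva w (Finset.mem_union_right _ hw)) hov hle
      rw [hUc] at this
      convert this using 3
      push_cast
      ring

/-- The auxiliary pairs `W` serve only to enlarge the set being averaged over. They are discarded
and rebuilt after each choice, except for a vertex that enters the chosen pair. -/
theorem IsUniversal.exists_pairs (h : IsUniversal t a H G)
    (hφ : ∀ n, IsUnitAssignment (φ n)) (hF : EventuallyProper G φ F) {k m : ℕ} (hm : 0 < m)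
    (hkm : 2 * k + m < t) (ha : a + k = t) (j : ℕ) (hj : j ≤ k) :
    ∃ P : Finset ℕ, P.card = 2 * j ∧ Live H t P ∧ CliqueLE G P j ∧
      ∀ᶠ n in F, overlap (φ n) P ≤
        ∑ i ∈ Finset.range j,
          (1 + (k : ℝ) / ((t - 2 * k : ℕ) : ℝ) / m) / ((t - m - 2 * i : ℕ) : ℝ) := by
  induction j with
  | zero =>
    refine ⟨∅, by simp, h.live_empty, cliqueLE_card G ∅, ?_⟩
    simp [overlap_empty]
  | succ j ih =>
    obtain ⟨P, hPc, hP, hPb, hPov⟩ := ih (by omega)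
    obtain ⟨W, hWc, hd, hlive, hWb, hadj, hov⟩ := h.exists_pairs_of_clique hφ hF hP hPb
      (q := t - 2 * k) (by omega) (k - j) (by omega) (by omega)
    have hPWc : (P ∪ W).card = 2 * k := by
      rw [Finset.card_union_of_disjoint hd, hWc]; omega
    -- This size brings `P ∪ W ∪ U` to `t - m` vertices, leaving room for exactly the `m` vertices
    -- of `V`.
    obtain ⟨U, hUc, hUd, hUlive, hU, hUadj⟩ := h.exists_clique_extension subset_rfl hlive
      (hPb.union hWb) (t - m - 2 * k) (by omega) (by omega)
    rw [Finset.disjoint_union_left] at hUd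
    have hWUc : (W ∪ U).card = t - m - 2 * j := by
      rw [Finset.card_union_of_disjoint hUd.2, hWc, hUc]; omega
    have hWUov := eventually_overlap_union_clique_le hφ hF hUd.2 hU
      (fun x hx y hy => (hUadj x hx y (Finset.mem_union_right _ hy)).2
        (Finset.mem_union_right _ hy)) hov
    obtain ⟨u, v, huv, hnadj, hu, hv, hua, hva, hlive', hle⟩ := h.exists_pair hφ hF (m := m)
      (Q := P) (U := W ∪ U) (b := j) (Finset.disjoint_union_right.2 ⟨hd, hUd.1⟩)
      (by rwa [← Finset.union_assoc]) hm (Finset.card_pos.1 (by omega)) (by omega) hPb (by omega)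
      (by
        intro x hx y hy
        rcases Finset.mem_union.1 hx with hx | hx
        · exact hadj x hx y hy
        · exact (hUadj x hx y (Finset.mem_union_left _ hy)).2 (Finset.mem_union_left _ hy))
      hWUov
    refine ⟨insert u (insert v P), ?_, hlive', hPb.insert_pair hnadj, ?_⟩
    · rw [Finset.card_insert_of_notMem (by simp [huv, hu]),
        Finset.card_insert_of_notMem hv, hPc]
      ring
    · rw [Finset.sum_range_succ]
      refine eventually_overlap_insert_pair_le hφ hF huv hu hv hua hva hPov ?_
      filter_upwards [hle] with n hn
      rw [hWUc] at hn
      refine hn.trans ?_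
      gcongr
      exact Nat.sub_le _ _

/-- Some bag of `t + 1` vertices is colored with almost `t + 1` colors. -/
theorem IsUniversal.exists_bag (h : IsUniversal t a H G)
    (hφ : ∀ n, IsUnitAssignment (φ n)) (hF : EventuallyProper G φ F) {k m : ℕ} (hm : 0 < m)
    (hkm : 2 * k + m < t) (ha : a + k = t) :
    ∃ S : Finset ℕ, ∀ᶠ n in F, (t : ℝ) + 1 - ∑ i ∈ Finset.range k,
        (1 + (k : ℝ) / ((t - 2 * k : ℕ) : ℝ) / m) / ((t - m - 2 * i : ℕ) : ℝ) ≤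
      volume.real (⋃ v ∈ S, φ n v) := by
  obtain ⟨P, hPc, hP, hPb, hPov⟩ := h.exists_pairs hφ hF hm hkm ha k le_rfl
  obtain ⟨U, hUc, hUd, hUlive, hU, hUadj⟩ := h.exists_clique_extension subset_rfl hP
    hPb (t - 2 * k) (by omega) (by omega)
  have hPUc : (P ∪ U).card = t := by
    rw [Finset.card_union_of_disjoint hUd, hPc, hUc]; omega
  have hov := eventually_overlap_union_clique_le hφ hF hUd hU
    (fun x hx y hy => (hUadj x hx y hy).2 hy) hPov
  obtain ⟨K, hK, hPUK⟩ := hUlive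
  -- Cliques in `P ∪ U` have at most `k + (t - 2 * k) = a` vertices, so one vertex adjacent to
  -- everything may still be added.
  obtain ⟨x, -, hxH, hxG⟩ := h.extend K (P ∪ U) hK hPUK
    ((hPb.union (cliqueLE_card G U)).mono subset_rfl (by omega)) 0
  have hxadj : ∀ u ∈ P ∪ U, G.Adj x u := fun u hu => (hxG u (hPUK hu)).2 hu
  have hx : x ∉ P ∪ U := fun hx => G.irrefl (hxadj x hx)
  refine ⟨insert x (P ∪ U), ?_⟩
  filter_upwards [hov, hF (insert x (P ∪ U))] with n h1 h2
  have h3 := overlap_insert_of_disjoint (hφ n) hx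
    fun u hu => h2 x (by simp) u (Finset.mem_insert_of_mem hu) (hxadj u hu)
  have h4 : overlap (φ n) (insert x (P ∪ U)) =
      (t : ℝ) + 1 - volume.real (⋃ v ∈ insert x (P ∪ U), φ n v) := by
    rw [overlap, Finset.card_insert_of_notMem hx, hPUc]
    push_cast
    ring
  linarith

/-! ### Finite initial segments: treewidth and clique number. -/

lemma isNClique_comap {V W : Type*} {H : SimpleGraph W} {t : ℕ} (f : V ↪ W) {K : Finset V}
    (h : H.IsNClique t (K.map f)) : (H.comap f).IsNClique t K := by
  rw [SimpleGraph.isNClique_iff] at h ⊢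
  rw [Finset.card_map] at h
  refine ⟨fun u hu v hv huv => ?_, h.2⟩
  exact h.1 (by simpa using hu) (by simpa using hv) (f.injective.ne huv)

lemma BuildsTree.comap {V W : Type*} {H : SimpleGraph W} {t : ℕ} (f : V ↪ W) {S : Finset W}
    (h : BuildsTree H t S) : ∀ S' : Finset V, S'.map f = S → BuildsTree (H.comap f) t S' := by
  classical
  induction h with
  | base K hK =>
    rintro S' rfl
    exact .base _ (isNClique_comap f hK)
  | step S K v hv hS hKS hK hadj ih =>
    intro S' hS'
    have hvS' : v ∈ S'.map f := hS' ▸ Finset.mem_cons_self v S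
    obtain ⟨x, hx, rfl⟩ := Finset.mem_map.1 hvS'
    have hS'' : (S'.erase x).map f = S := by
      rw [Finset.map_erase, hS', Finset.cons_eq_insert, Finset.erase_insert hv]
    obtain ⟨K', hK'S, rfl⟩ := Finset.subset_map_iff.1 (hKS.trans_eq hS''.symm)
    have := BuildsTree.step (H := H.comap f) (t := t) (S'.erase x) K' x (by simp) (ih _ hS'') hK'S
      (isNClique_comap f hK) (by
        intro u hu
        have := hadj (f u) (hS'' ▸ Finset.mem_map_of_mem f hu)
        simpa using this)
    rwa [Finset.cons_eq_insert, Finset.insert_erase hx] at this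

open Classical in
/-- A `t`-tree is `t`-degenerate. -/
lemma BuildsTree.exists_card_filter_le {W : Type*} {H : SimpleGraph W} {t : ℕ} {S : Finset W}
    (h : BuildsTree H t S) : ∀ T ⊆ S, T.Nonempty → ∃ x ∈ T, (T.filter (H.Adj x)).card ≤ t := by
  induction h with
  | base K hK =>
    intro T hT ⟨x, hx⟩
    refine ⟨x, hx, ?_⟩
    rw [← hK.card_eq]
    exact Finset.card_le_card ((Finset.filter_subset _ _).trans hT)
  | step S K v hv hS hKS hK hadj ih =>
    intro T hT hne
    by_cases hvT : v ∈ T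
    · refine ⟨v, hvT, ?_⟩
      rw [← hK.card_eq]
      refine Finset.card_le_card fun u hu => ?_
      obtain ⟨huT, hvu⟩ := Finset.mem_filter.1 hu
      rcases Finset.mem_cons.1 (hT huT) with rfl | huS
      · exact absurd hvu H.irrefl
      · exact (hadj u huS).1 hvu
    · refine ih T (fun u hu => ?_) hne
      rcases Finset.mem_cons.1 (hT hu) with rfl | huS
      · exact absurd hu hvT
      · exact huS

open Classical in
lemma IsPartialTree.le_of_forall_le_card_filter {V : Type*} {G : SimpleGraph V} {s d : ℕ}
    (h : IsPartialTree s G) {T : Finset V} (hT : T.Nonempty)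
    (hd : ∀ x ∈ T, d ≤ (T.filter (G.Adj x)).card) : d ≤ s := by
  obtain ⟨n, H, hH, ⟨f⟩⟩ := h
  obtain ⟨y, hy, hle⟩ := hH.exists_card_filter_le (T.map f.toEmbedding) (Finset.subset_univ _)
    (by simpa using hT)
  obtain ⟨x, hx, rfl⟩ := Finset.mem_map.1 hy
  refine (hd x hx).trans (le_trans ?_ hle)
  rw [← Finset.card_map f.toEmbedding]
  refine Finset.card_le_card fun z hz => ?_
  obtain ⟨w, hw, rfl⟩ := Finset.mem_map.1 hz
  obtain ⟨hwT, hadj⟩ := Finset.mem_filter.1 hw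
  exact Finset.mem_filter.2 ⟨Finset.mem_map_of_mem _ hwT, f.toHom.map_adj hadj⟩

/-- The subgraph induced by the first `n` vertices. -/
def initialGraph (G : SimpleGraph ℕ) (n : ℕ) : SimpleGraph (Fin n) := G.comap Fin.valEmbedding

lemma map_valEmbedding_univ (n : ℕ) :
    (Finset.univ : Finset (Fin n)).map Fin.valEmbedding = Finset.range n := by
  ext x
  simp only [Finset.mem_map, Finset.mem_univ, true_and, Fin.valEmbedding_apply, Finset.mem_range]
  exact ⟨fun ⟨y, hy⟩ => hy ▸ y.2, fun hx => ⟨⟨x, hx⟩, rfl⟩⟩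

lemma exists_map_valEmbedding_eq {n : ℕ} {S : Finset ℕ} (hS : S ⊆ Finset.range n) :
    ∃ T : Finset (Fin n), T.map Fin.valEmbedding = S := by
  rw [← map_valEmbedding_univ] at hS
  obtain ⟨T, -, hT⟩ := Finset.subset_map_iff.1 hS
  exact ⟨T, hT.symm⟩

lemma IsUniversal.isPartialTree (h : IsUniversal t a H G) {n : ℕ} (hn : t ≤ n) :
    IsPartialTree t (initialGraph G n) := by
  refine ⟨n, H.comap Fin.valEmbedding,
    (h.buildsTree n hn).comap Fin.valEmbedding _ (map_valEmbedding_univ n), ?_⟩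
  exact SimpleGraph.IsContained.of_le (SimpleGraph.comap_monotone _ h.le)

lemma subset_range_of_sup_lt {S : Finset ℕ} {n : ℕ} (h : S.sup id < n) : S ⊆ Finset.range n :=
  fun _ hu => Finset.mem_range.2 ((Finset.le_sup (f := id) hu).trans_lt h)

open Classical in
-- For the lower bound, the independent base and `t` common neighbors of it give minimum degree at
-- least `t`, while subgraphs of an `s`-tree are `s`-degenerate.
lemma IsUniversal.eventually_treewidth_eq (h : IsUniversal t a H G) (ha : 0 < a) (ht : 0 < t) :
    ∀ᶠ n in atTop, treewidth (initialGraph G n) = t := by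
  have hinf : {v | ∀ u ∈ Finset.range t, G.Adj v u}.Infinite := by
    refine Set.infinite_of_forall_exists_gt fun N => ?_
    obtain ⟨v, hv, -, hadj⟩ := h.extend _ _ h.base subset_rfl
      ((cliqueLE_of_indep h.base_indep).mono subset_rfl ha) (N + 1)
    exact ⟨v, fun u hu => (hadj u hu).2 hu, hv⟩
  obtain ⟨V, hV, hVt⟩ := hinf.exists_subset_card_eq t
  filter_upwards [eventually_ge_atTop t, eventually_gt_atTop (V.sup id)] with n hn hVn
  refine le_antisymm (Nat.sInf_le (h.isPartialTree hn)) (le_csInf ⟨t, h.isPartialTree hn⟩ ?_)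
  intro s hs
  have hVr := subset_range_of_sup_lt hVn
  have hBr : Finset.range t ⊆ Finset.range n := Finset.range_subset_range.2 hn
  obtain ⟨T, hT⟩ := exists_map_valEmbedding_eq (Finset.union_subset hBr hVr)
  have hT' : ∀ x : Fin n, x ∈ T ↔ (x : ℕ) ∈ Finset.range t ∪ V := by
    intro x
    rw [← hT]
    exact (Finset.mem_map' Fin.valEmbedding).symm
  have key : ∀ X : Finset ℕ, X ⊆ Finset.range t ∪ V → X ⊆ Finset.range n → X.card = t →
      ∀ x : Fin n, (∀ y ∈ X, G.Adj x y) → t ≤ (T.filter ((initialGraph G n).Adj x)).card := by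
    intro X hX hXn hXt x hx
    obtain ⟨Y, rfl⟩ := exists_map_valEmbedding_eq hXn
    rw [← hXt, Finset.card_map]
    refine Finset.card_le_card fun y hy => ?_
    have hy' : (y : ℕ) ∈ Y.map Fin.valEmbedding := Finset.mem_map_of_mem Fin.valEmbedding hy
    exact Finset.mem_filter.2 ⟨(hT' y).2 (hX hy'), hx y hy'⟩
  refine IsPartialTree.le_of_forall_le_card_filter hs (T := T) ?_ ?_
  · exact ⟨⟨0, by omega⟩, (hT' _).2 (by simp [ht])⟩
  · intro x hx
    rcases Finset.mem_union.1 ((hT' x).1 hx) with hx | hx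
    · exact key V Finset.subset_union_right hVr hVt x fun y hy => (hV hy x hx).symm
    · exact key _ Finset.subset_union_left hBr (by simp) x fun y hy => hV hx y hy

lemma IsUniversal.eventually_cliqueNum_eq (h : IsUniversal t a H G) (hat : a < t) :
    ∀ᶠ n in atTop, (initialGraph G n).cliqueNum = a + 1 := by
  obtain ⟨U, hUc, -, -, hU, -⟩ := h.exists_clique_extension (subset_refl ∅) h.live_empty
    (cliqueLE_card G ∅) (a + 1) (by simpa using hat) (by simp)
  filter_upwards [eventually_gt_atTop (U.sup id)] with n hn
  refine le_antisymm ?_ ?_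
  · obtain ⟨s, hs⟩ := (initialGraph G n).exists_isNClique_cliqueNum
    rw [← hs.card_eq, ← Finset.card_map Fin.valEmbedding]
    refine h.cliqueLE _ _ subset_rfl ?_
    intro u hu v hv huv
    obtain ⟨x, hx, rfl⟩ := Finset.mem_map.1 (Finset.mem_coe.1 hu)
    obtain ⟨y, hy, rfl⟩ := Finset.mem_map.1 (Finset.mem_coe.1 hv)
    exact hs.isClique hx hy fun e => huv (by rw [e])
  · obtain ⟨Y, rfl⟩ := exists_map_valEmbedding_eq (subset_range_of_sup_lt hn)
    have hY : (initialGraph G n).IsNClique (a + 1) Y :=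
      isNClique_comap _ (SimpleGraph.isNClique_iff _ |>.2 ⟨hU, hUc⟩)
    rw [← hY.card_eq]
    exact SimpleGraph.IsClique.card_le_cliqueNum (tc := hY.isClique)

/-! ### The fractional chromatic number of initial segments. -/

lemma exists_coloring_of_fractionalChromaticNumber_lt {n : ℕ} {G : SimpleGraph (Fin n)} {x : ℝ}
    (h : fractionalChromaticNumber G < x) :
    ∃ φ, IsFractionalColoring G φ ∧ volume (⋃ v, φ v) < ENNReal.ofReal x := by
  -- Finiteness matters because `toReal` sends `⊤` to `0`; disjoint unit intervals provide a
  -- coloring.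
  have hfin : (⨅ (φ : Fin n → Set ℝ) (_ : IsFractionalColoring G φ), volume (⋃ v, φ v)) ≠ ⊤ := by
    have hcol : IsFractionalColoring G fun v : Fin n => Set.Ico ((v : ℕ) : ℝ) ((v : ℕ) + 1) := by
      refine ⟨fun v => measurableSet_Ico.nullMeasurableSet, fun v => by simp, fun u v huv => ?_⟩
      rw [Set.disjoint_left]
      intro y hy hy'
      have h1 : (u : ℕ) < (v : ℕ) + 1 := by exact_mod_cast hy.1.trans_lt hy'.2
      have h2 : (v : ℕ) < (u : ℕ) + 1 := by exact_mod_cast hy'.1.trans_lt hy.2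
      exact huv.ne (Fin.ext (by omega))
    refine ((iInf₂_le _ hcol).trans_lt ((measure_iUnion_le _).trans_lt ?_)).ne
    rw [tsum_fintype]
    simp
  have h' := (ENNReal.lt_ofReal_iff_toReal_lt hfin).2 h
  obtain ⟨φ, hφ⟩ := iInf_lt_iff.1 h'
  obtain ⟨hc, hlt⟩ := iInf_lt_iff.1 hφ
  exact ⟨φ, hc, hlt⟩

theorem IsUniversal.frequently_le_fractionalChromaticNumber (h : IsUniversal t a H G) {k m : ℕ}
    (hm : 0 < m) (hkm : 2 * k + m < t) (ha : a + k = t) :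
    ∃ᶠ n in atTop, (t : ℝ) + 1 - ∑ i ∈ Finset.range k,
        (1 + (k : ℝ) / ((t - 2 * k : ℕ) : ℝ) / m) / ((t - m - 2 * i : ℕ) : ℝ) ≤
      fractionalChromaticNumber (initialGraph G n) := by
  set x : ℝ := (t : ℝ) + 1 - ∑ i ∈ Finset.range k,
        (1 + (k : ℝ) / ((t - 2 * k : ℕ) : ℝ) / m) / ((t - m - 2 * i : ℕ) : ℝ) with hx
  intro hev
  simp only [not_le] at hev
  have hex : ∀ n, ∃ φ : ℕ → Set ℝ, IsUnitAssignment φ ∧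
      (fractionalChromaticNumber (initialGraph G n) < x →
        (∀ u < n, ∀ v < n, G.Adj u v → Disjoint (φ u) (φ v)) ∧
        volume (⋃ v ∈ Finset.range n, φ v) < ENNReal.ofReal x) := by
    intro n
    by_cases hlt : fractionalChromaticNumber (initialGraph G n) < x
    · obtain ⟨ψ, hψ, hvol⟩ := exists_coloring_of_fractionalChromaticNumber_lt hlt
      refine ⟨fun v => if hv : v < n then ψ ⟨v, hv⟩ else Set.Ico 0 1, fun v => ?_, fun _ => ⟨?_, ?_⟩⟩
      · by_cases hv : v < n
        · simp only [hv, dite_true]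
          exact ⟨hψ.measurable _, hψ.volume_eq_one _⟩
        · simp [hv]
      · intro u hu v hv huv
        simp only [hu, hv, dite_true]
        exact hψ.disjoint _ _ huv
      · refine (measure_mono (Set.iUnion₂_subset fun v hv => ?_)).trans_lt hvol
        simp only [Finset.mem_range.1 hv, dite_true]
        exact Set.subset_iUnion ψ ⟨v, Finset.mem_range.1 hv⟩
    · exact ⟨fun _ => Set.Ico 0 1, fun v => by simp, fun h => absurd h hlt⟩
  choose φ hφ hcol using hex
  have hF : (hyperfilter ℕ : Filter ℕ) ≤ atTop := Nat.hyperfilter_le_atTop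
  have hproper : EventuallyProper G φ (hyperfilter ℕ) := by
    intro S
    filter_upwards [hF hev, hF (eventually_gt_atTop (S.sup id))] with n hn hS u hu v hv huv
    have hS := subset_range_of_sup_lt hS
    exact (hcol n hn).1 u (Finset.mem_range.1 (hS hu)) v (Finset.mem_range.1 (hS hv)) huv
  obtain ⟨S, hS⟩ := h.exists_bag hφ hproper hm hkm ha
  obtain ⟨n, hn, hlt, hSn⟩ := (hS.and
    ((hev.filter_mono hF).and ((eventually_gt_atTop (S.sup id)).filter_mono hF))).exists
  have h1 : volume (⋃ v ∈ S, φ n v) < ENNReal.ofReal x :=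
    (measure_mono (Set.biUnion_subset_biUnion_left
      (fun v hv => subset_range_of_sup_lt hSn hv))).trans_lt (hcol n hlt).2
  exact absurd ((ENNReal.lt_ofReal_iff_toReal_lt ((hφ n).biUnion_ne_top S)).1 h1) (not_lt.2 hn)

theorem exists_graph {t k m : ℕ} (hk : 0 < k) (hm : 0 < m) (hkm : 2 * k + m < t) :
    ∃ (n : ℕ) (G : SimpleGraph (Fin n)), treewidth G = t ∧ G.cliqueNum = t + 1 - k ∧
      (t : ℝ) + 1 - ∑ i ∈ Finset.range k,
        (1 + (k : ℝ) / ((t - 2 * k : ℕ) : ℝ) / m) / ((t - m - 2 * i : ℕ) : ℝ) ≤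
      fractionalChromaticNumber G := by
  obtain ⟨H, G, h⟩ := exists_isUniversal t (t - k)
  obtain ⟨n, h1, h2, h3⟩ := ((h.frequently_le_fractionalChromaticNumber hm hkm
    (by omega)).and_eventually ((h.eventually_treewidth_eq (by omega) (by omega)).and
      (h.eventually_cliqueNum_eq (by omega)))).exists
  exact ⟨n, initialGraph G n, h2, by omega, h1⟩

/-! ### Asymptotics of the total overlap. -/

/-- Telescoping, from `log (y / (y - 2)) ≥ 1 - (y - 2) / y = 2 / y`. -/
lemma sum_range_inv_sub_two_mul_le {N k : ℕ} (h : 2 * k < N) :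
    ∑ i ∈ Finset.range k, ((N - 2 * i : ℕ) : ℝ)⁻¹ ≤
      1 / 2 * Real.log ((N : ℝ) / (N - 2 * k)) := by
  induction k with
  | zero =>
    have : (N : ℝ) ≠ 0 := by norm_cast; omega
    simp [this]
  | succ k ih =>
    have ih := ih (by omega)
    have hlt : (2 : ℝ) * k + 2 < N := by exact_mod_cast (by omega : 2 * k + 2 < N)
    have hk : (0 : ℝ) ≤ k := by positivity
    rw [Finset.sum_range_succ, Nat.cast_sub (by omega)]
    push_cast
    set y : ℝ := N - 2 * k with hy
    have hy2 : 0 < y - 2 := by linarith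
    have hy0 : 0 < y := by linarith
    have e1 : (N : ℝ) - 2 * (k + 1) = y - 2 := by rw [hy]; ring
    have e2 : (N : ℝ) / (y - 2) = N / y * (y / (y - 2)) := by field_simp
    have hN : (0 : ℝ) < N := by linarith
    rw [e1, e2, Real.log_mul (by positivity) (by positivity)]
    have h1 := Real.one_sub_inv_le_log_of_pos (div_pos hy0 hy2)
    have h2 : 1 - (y / (y - 2))⁻¹ = 2 * y⁻¹ := by field_simp; ring
    linarith

/-- The number of non-adjacent pairs in a bag. -/
noncomputable def pairCount (c : ℝ) (t : ℕ) : ℕ := t + 1 - ⌊(1 - c) * (t : ℝ)⌋₊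

/-- The error term. -/
noncomputable def errorTerm (c : ℝ) (t : ℕ) : ℝ :=
  (1 + (pairCount c t : ℝ) / (t - 2 * pairCount c t) / Nat.sqrt t) *
    (1 / 2 * Real.log (((t : ℝ) - Nat.sqrt t) / (t - Nat.sqrt t - 2 * pairCount c t))) +
  1 / 2 * Real.log (1 - 2 * c)

lemma floor_le_of_pos {c : ℝ} (hc : 0 ≤ c) (t : ℕ) : ⌊(1 - c) * (t : ℝ)⌋₊ ≤ t := by
  have : (1 - c) * (t : ℝ) ≤ t := by nlinarith [Nat.cast_nonneg (α := ℝ) t]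
  exact (Nat.floor_le_floor this).trans_eq (Nat.floor_natCast t)

lemma tendsto_sqrt_div : Tendsto (fun t : ℕ => (Nat.sqrt t : ℝ) / t) atTop (𝓝 0) := by
  have h : Tendsto (fun t : ℕ => (Real.sqrt t)⁻¹) atTop (𝓝 0) :=
    (Real.tendsto_sqrt_atTop.comp tendsto_natCast_atTop_atTop).inv_tendsto_atTop
  refine squeeze_zero (fun t => by positivity) (fun t => ?_) h
  have h1 : (Nat.sqrt t : ℝ) ≤ Real.sqrt t := Real.nat_sqrt_le_real_sqrt
  calc (Nat.sqrt t : ℝ) / t ≤ Real.sqrt t / t := by gcongr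
    _ = (Real.sqrt t)⁻¹ := Real.sqrt_div_self

lemma tendsto_pairCount_div {c : ℝ} (hc : 0 ≤ c) (hc' : c ≤ 1) :
    Tendsto (fun t : ℕ => (pairCount c t : ℝ) / t) atTop (𝓝 c) := by
  have h1 : Tendsto (fun t : ℕ => (⌊(1 - c) * (t : ℝ)⌋₊ : ℝ) / t) atTop (𝓝 (1 - c)) :=
    (tendsto_nat_floor_mul_div_atTop (by linarith)).comp tendsto_natCast_atTop_atTop
  have h2 : Tendsto (fun t : ℕ => (1 : ℝ) + 1 / t - (⌊(1 - c) * (t : ℝ)⌋₊ : ℝ) / t) atTop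
      (𝓝 (1 + 0 - (1 - c))) :=
    (tendsto_const_nhds.add tendsto_one_div_atTop_nhds_zero_nat).sub h1
  rw [show 1 + 0 - (1 - c) = c by ring] at h2
  refine h2.congr' ?_
  filter_upwards [eventually_gt_atTop 0] with t ht
  have ht' : (t : ℝ) ≠ 0 := by positivity
  rw [pairCount, Nat.cast_sub ((floor_le_of_pos hc t).trans (Nat.le_succ t))]
  push_cast
  field_simp

lemma tendsto_sqrt_atTop : Tendsto (fun t : ℕ => (Nat.sqrt t : ℝ)) atTop atTop := by
  refine tendsto_natCast_atTop_atTop.comp (tendsto_atTop.2 fun b => ?_)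
  filter_upwards [eventually_ge_atTop (b * b)] with t ht
  exact Nat.le_sqrt.2 ht

lemma tendsto_errorTerm {c : ℝ} (hc0 : 0 < c) (hc : c < 1 / 2) :
    Tendsto (errorTerm c) atTop (𝓝 0) := by
  have hk := tendsto_pairCount_div hc0.le (by linarith)
  have hm := tendsto_sqrt_div
  have hne : (1 : ℝ) - 2 * c ≠ 0 := by linarith
  have h1 : Tendsto (fun t : ℕ => (1 : ℝ) + (pairCount c t : ℝ) / t /
      (1 - 2 * ((pairCount c t : ℝ) / t)) * (Nat.sqrt t : ℝ)⁻¹) atTop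
      (𝓝 (1 + c / (1 - 2 * c) * 0)) :=
    tendsto_const_nhds.add ((hk.div (tendsto_const_nhds.sub (hk.const_mul 2)) hne).mul
      tendsto_sqrt_atTop.inv_tendsto_atTop)
  have h2 : Tendsto (fun t : ℕ => Real.log ((1 - (Nat.sqrt t : ℝ) / t) /
      (1 - (Nat.sqrt t : ℝ) / t - 2 * ((pairCount c t : ℝ) / t)))) atTop
      (𝓝 (Real.log ((1 - 0) / (1 - 0 - 2 * c)))) := by
    refine Tendsto.log ?_ (by rw [sub_zero]; positivity)
    exact (tendsto_const_nhds.sub hm).div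
      ((tendsto_const_nhds.sub hm).sub (hk.const_mul 2)) (by simpa using hne)
  have h3 := (h1.mul (h2.const_mul (1 / 2))).add_const (1 / 2 * Real.log (1 - 2 * c))
  have e : (1 + c / (1 - 2 * c) * 0) * (1 / 2 * Real.log ((1 - 0) / (1 - 0 - 2 * c))) +
      1 / 2 * Real.log (1 - 2 * c) = 0 := by
    rw [sub_zero, one_div (1 - 2 * c), Real.log_inv]
    ring
  rw [e] at h3
  refine h3.congr' ?_
  filter_upwards [eventually_gt_atTop 0] with t ht
  have ht' : (t : ℝ) ≠ 0 := by positivity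
  have e1 : (pairCount c t : ℝ) / t / (1 - 2 * ((pairCount c t : ℝ) / t)) =
      (pairCount c t : ℝ) / (t - 2 * pairCount c t) := by
    rw [← mul_div_mul_right ((pairCount c t : ℝ) / t) _ ht']
    congr 1 <;> field_simp
  have e2 : (1 - (Nat.sqrt t : ℝ) / t) /
      (1 - (Nat.sqrt t : ℝ) / t - 2 * ((pairCount c t : ℝ) / t)) =
      ((t : ℝ) - Nat.sqrt t) / (t - Nat.sqrt t - 2 * pairCount c t) := by
    rw [← mul_div_mul_right (1 - (Nat.sqrt t : ℝ) / t) _ ht']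
    congr 1 <;> field_simp
  rw [errorTerm, e1, e2, ← div_eq_mul_inv]

end FracTreewidth

theorem theorem2 (c : ℝ) (hc0 : 0 < c) (hc : c < 1 / 2) :
    ∃ ε : ℕ → ℝ, Tendsto ε atTop (𝓝 0) ∧
      ∀ᶠ t : ℕ in atTop, ∃ (n : ℕ) (G : SimpleGraph (Fin n)),
        FracTreewidth.treewidth G = t ∧
        G.cliqueNum = ⌊(1 - c) * (t : ℝ)⌋₊ ∧
        FracTreewidth.fractionalChromaticNumber G
          ≥ (t : ℝ) + 1 + 1 / 2 * Real.log (1 - 2 * c) - ε t := by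
  refine ⟨FracTreewidth.errorTerm c, FracTreewidth.tendsto_errorTerm hc0 hc, ?_⟩
  have hlim : Tendsto (fun t : ℕ => 2 * ((FracTreewidth.pairCount c t : ℝ) / t) +
      (Nat.sqrt t : ℝ) / t) atTop (𝓝 (2 * c + 0)) :=
    ((FracTreewidth.tendsto_pairCount_div hc0.le (by linarith)).const_mul 2).add
      FracTreewidth.tendsto_sqrt_div
  filter_upwards [hlim.eventually_lt_const (show 2 * c + 0 < 1 by linarith),
    eventually_gt_atTop 0] with t hlt ht
  have hfl := FracTreewidth.floor_le_of_pos hc0.le t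
  have ht' : (0 : ℝ) < t := by exact_mod_cast ht
  set k := FracTreewidth.pairCount c t with hk
  have hk' : k = t + 1 - ⌊(1 - c) * (t : ℝ)⌋₊ := rfl
  -- Any `m` with `m → ∞` and `m / t → 0` would do: the first removes the overlap of the auxiliary
  -- pairs, the second keeps the logarithm's limit.
  set m := Nat.sqrt t with hm
  have hm0 : 0 < m := Nat.sqrt_pos.2 ht
  have hkm : 2 * k + m < t := by
    have : (2 * k + m : ℝ) < t := by
      rw [← mul_div_assoc, ← add_div, div_lt_one ht'] at hlt
      exact hlt
    exact_mod_cast this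
  obtain ⟨n, G, h1, h2, h3⟩ := FracTreewidth.exists_graph (by omega : 0 < k) hm0 hkm
  refine ⟨n, G, h1, h2.trans (by omega), le_trans ?_ h3⟩
  have hsum := FracTreewidth.sum_range_inv_sub_two_mul_le (N := t - m) (k := k) (by omega)
  rw [Nat.cast_sub (by omega : m ≤ t)] at hsum
  rw [Nat.cast_sub (by omega : 2 * k ≤ t)]
  push_cast
  simp only [div_eq_mul_inv (1 + _ : ℝ)]
  rw [← Finset.mul_sum, FracTreewidth.errorTerm, ← hk, ← hm]
  have hpos : (0 : ℝ) ≤ 1 + (k : ℝ) / (t - 2 * k) / m := by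
    have : (0 : ℝ) < t - 2 * k := by
      have : ((2 * k + m : ℕ) : ℝ) < t := by exact_mod_cast hkm
      push_cast at this
      have : (0 : ℝ) ≤ m := by positivity
      linarith
    positivity
  have := mul_le_mul_of_nonneg_left hsum hpos
  linarith
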